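/- Let $d\in\mathbb N$, $n\ge 3$, $0=t_1<t_2<\dots<t_n=1$, and let $\rho_1,\dots,\rho_n$ be compactly supported Borel probability measures on $\mathbb R^d$, with $\rho_1$ atomless. Let $\mathcal H=H^2([0,1],\mathbb R^d)$ be the Sobolev space of paths with square-integrable weak first and second derivatives (each path identified with its continuous representative), equipped with its Borel $\sigma$-algebra, and let $e_t(x)=x(t)$. **Kantorovich problem.** Let $$K=\inf_{\mu}\int_{\mathcal H}\int_0^1|\ddot x(t)|^2\,dt\,d\mu(x),$$ where $\mu$ runs over the Borel probability measures on $\mathcal H$ with $(e_{t_i})_*\mu=\rho_i$ for $i=1,\dots,n$. **Monge spline problem.** For a reference probability measure $\mu_0$ on $\mathbb R^d$, let $$MS(\mu_0)=\inf_{\varphi}\int_{\mathbb R^d}\int_0^1|\ddot\varphi(t,x)|^2\,dt\,d\mu_0(x),$$ where $\varphi$ runs over the time-dependent maps $\varphi:[0,1]\times\mathbb R^d\to\mathbb R^d$ such that $\varphi(t,\cdot)$ is Borel for every $t$, $\varphi(\cdot,x)\in\mathcal H$ for every $x$, and $\varphi(t_i,\cdot)_*\mu_0=\rho_i$ for $i=1,\dots,n$.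 Let $MS_{\mathrm{id}}$ be the infimum of the same functional for $\mu_0=\rho_1$ over those admissible $\varphi$ that moreover satisfy $\varphi(0,x)=x$ for all $x$. Then: 1. $MS(\mu_0)=K$ for every atomless Borel probability measure $\mu_0$ on $\mathbb R^d$ (in particular for $\mu_0=\rho_1$); 2. $MS_{\mathrm{id}}=K$; 3. $K<\infty$, and $K$ is attained: there is an admissible $\mu$ whose cost is $K$. -/

import Mathlib

open MeasureTheory Set
open scoped ENNReal ContDiff unitInterval

noncomputable section

namespace WassersteinSpline

/-- The Euclidean space `ℝ^d`. -/
abbrev Rd (d : ℕ) : Type := EuclideanSpace ℝ (Fin d)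

/-- The space `L²([0,1], ℝ^d)` (Lebesgue measure on `[0,1]`). -/
abbrev L2Path (d : ℕ) : Type := Lp (Rd d) 2 (volume : Measure I)

/-- `g` is the weak (distributional) derivative of `f` on `(0,1)`:
`∫ ψ' f = - ∫ ψ g` for every smooth `ψ` compactly supported in `(0,1)`. -/
def IsWeakDeriv {d : ℕ} (f g : I → Rd d) : Prop :=
  ∀ ψ : ℝ → ℝ, ContDiff ℝ ∞ ψ → HasCompactSupport ψ → tsupport ψ ⊆ Ioo (0 : ℝ) 1 →
    ∫ s : I, deriv ψ (s : ℝ) • f s = - ∫ s : I, ψ (s : ℝ) • g s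

/-- The Sobolev path space `H²([0,1], ℝ^d)`: a path (given by its continuous representative)
together with its weak first and second derivatives, both in `L²`. The derivatives are determined
by the path. The topology is the one inherited from `C⁰ × L² × L²`, i.e. that of the norm
`max (‖x‖_∞, ‖x'‖_{L²}, ‖x''‖_{L²})`, which is equivalent to the usual Hilbert norm of `H²`
because `H²([0,1])` embeds continuously in `C⁰([0,1])`. -/
def H2Path (d : ℕ) : Type :=
  {p : C(I, Rd d) × L2Path d × L2Path d //
    IsWeakDeriv (fun s => p.1 s) (fun s => p.2.1 s) ∧
    IsWeakDeriv (fun s => p.2.1 s) (fun s => p.2.2 s)}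

instance (d : ℕ) : TopologicalSpace (H2Path d) :=
  inferInstanceAs (TopologicalSpace (Subtype _))

/-- The path space carries its Borel σ-algebra. -/
instance (d : ℕ) : MeasurableSpace (H2Path d) := borel (H2Path d)

instance (d : ℕ) : BorelSpace (H2Path d) := ⟨rfl⟩

/-- The evaluation map `e_s : H²([0,1], ℝ^d) → ℝ^d`, `x ↦ x(s)`. -/
def eval {d : ℕ} (s : I) (x : H2Path d) : Rd d := x.1.1 s

/-- The acceleration `ẍ ∈ L²([0,1], ℝ^d)` of a path `x ∈ H²([0,1], ℝ^d)`. -/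
def acc {d : ℕ} (x : H2Path d) : L2Path d := x.1.2.2

/-- `|ẍ|² = ∫₀¹ |ẍ(s)|² ds`. -/
def energy {d : ℕ} (x : H2Path d) : ℝ≥0∞ := ∫⁻ s : I, ‖acc x s‖ₑ ^ 2

/-- Evaluation is continuous, hence Borel, so that the image measures `[e_s]_* μ` make sense. -/
theorem continuous_eval {d : ℕ} (s : I) : Continuous (eval s : H2Path d → Rd d) :=
  (ContinuousEvalConst.continuous_eval_const (F := C(I, Rd d)) s).comp
    (continuous_fst.comp continuous_subtype_val)

/-- Admissible measures of the Kantorovich problem: probability measures `μ` on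
`H²([0,1], ℝ^d)` with `[e_{t_i}]_* μ = ρ_i` for all `i`. -/
structure KantorovichAdmissible {d n : ℕ} (t : Fin n → I) (ρ : Fin n → Measure (Rd d))
    (μ : Measure (H2Path d)) : Prop where
  isProbabilityMeasure : IsProbabilityMeasure μ
  marginal : ∀ i, μ.map (eval (t i)) = ρ i

/-- The Kantorovich cost `∫_{H²} |ẍ|² dμ(x)`. -/
def kantorovichCost {d : ℕ} (μ : Measure (H2Path d)) : ℝ≥0∞ := ∫⁻ x, energy x ∂μ

/-- The infimum of the Kantorovich problem. -/
def kantorovichInf {d n : ℕ} (t : Fin n → I) (ρ : Fin n → Measure (Rd d)) : ℝ≥0∞ :=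
  ⨅ (μ : Measure (H2Path d)) (_ : KantorovichAdmissible t ρ μ), kantorovichCost μ

/-- Admissible time-dependent maps `φ(s) : ℝ^d → ℝ^d`, `φ(s)(x) = eval s (φ x)`, of the Monge
problem with reference measure `μ₀`: every trajectory `s ↦ φ(s)(x)` is in `H²`, every `φ(s)` is a
Borel map, and `φ(t_i)_* μ₀ = ρ_i` for all `i`. -/
structure MongeAdmissible {d n : ℕ} (μ₀ : Measure (Rd d)) (t : Fin n → I)
    (ρ : Fin n → Measure (Rd d)) (φ : Rd d → H2Path d) : Prop where
  measurable : ∀ s, Measurable fun x => eval s (φ x)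
  marginal : ∀ i, μ₀.map (fun x => eval (t i) (φ x)) = ρ i

/-- The Monge cost `∫_{ℝ^d} ∫₀¹ |φ̈(s)(x)|² ds dμ₀(x)`. -/
def mongeCost {d : ℕ} (μ₀ : Measure (Rd d)) (φ : Rd d → H2Path d) : ℝ≥0∞ :=
  ∫⁻ x, energy (φ x) ∂μ₀

/-- The infimum of the Monge spline problem (MS) with reference measure `μ₀`. -/
def mongeInf {d n : ℕ} (μ₀ : Measure (Rd d)) (t : Fin n → I) (ρ : Fin n → Measure (Rd d)) :
    ℝ≥0∞ :=
  ⨅ (φ : Rd d → H2Path d) (_ : MongeAdmissible μ₀ t ρ φ), mongeCost μ₀ φ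

/-- The infimum of the Monge spline problem (MS) with reference measure `μ₀`, restricted to the
time-dependent maps that start at the identity, `φ(0) = id`. -/
def mongeInfId {d n : ℕ} (μ₀ : Measure (Rd d)) (t : Fin n → I) (ρ : Fin n → Measure (Rd d)) :
    ℝ≥0∞ :=
  ⨅ (φ : Rd d → H2Path d) (_ : MongeAdmissible μ₀ t ρ φ) (_ : ∀ x, eval 0 (φ x) = x),
    mongeCost μ₀ φ

end WassersteinSpline

end

noncomputable section

namespace WassersteinSpline

open ProbabilityTheory Filter Topology

variable {d : ℕ}

/-! A Monge map `φ` pushes its reference measure to an admissible plan of the same cost, so every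
Monge infimum is at least the Kantorovich one. Conversely `H2Path d` is Polish, and an atomless
probability measure can be mapped onto any Borel probability measure on such a space
(`exists_measurable_map_eq_of_atomless`). A map that carries `μ₀` onto a plan `μ` is already a Monge
map with the cost of `μ`.

When the paths must start at `x`, transport alone does not suffice. Space is cut into cells of small
diameter, and the mass of `ρ i₀` in each cell is transported to the paths that start in that cell
(`exists_measurable_map_eq_of_atomless_of_partition`). The path given to `x` then starts close to
`x`; adding a small multiple of a Lagrange polynomial, equal to 1 at time 0 and to 0 at the other `t
i`, repairs the start at small cost.

For attainment, the least-energy path through given points depends linearly on them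
(`exists_minimal_interpolation`). The Kantorovich problem thus becomes a multimarginal problem on
`Fin n → Rd d` with a continuous cost, and the couplings of compactly supported marginals form a
compact set. -/

/-! ### Transport of atomless measures -/

/-- The distribution function of an atomless probability measure on `ℝ` is continuous. -/
theorem continuous_cdf_of_atomless (ν : Measure ℝ) [IsProbabilityMeasure ν]
    (hν : ∀ x, ν {x} = 0) : Continuous (cdf ν) := by
  refine continuous_iff_continuousAt.2 fun x => ?_
  rw [(monotone_cdf ν).continuousAt_iff_leftLim_eq_rightLim]
  have h1 : Function.rightLim (cdf ν) x = cdf ν x := (cdf ν).rightLim_eq x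
  have h2 := (cdf ν).measure_singleton x
  rw [measure_cdf, hν, eq_comm, ENNReal.ofReal_eq_zero] at h2
  rw [h1]
  exact le_antisymm ((monotone_cdf ν).leftLim_le le_rfl) (by linarith)

/-- The distribution function of an atomless probability measure on `ℝ` pushes it to the uniform
measure on the unit interval. -/
theorem map_cdf_eq_volume (ν : Measure ℝ) [IsProbabilityMeasure ν] (hν : ∀ x, ν {x} = 0) :
    ν.map (fun x => (⟨cdf ν x, cdf_nonneg ν x, cdf_le_one ν x⟩ : I)) = volume := by
  have hc := continuous_cdf_of_atomless ν hν
  have hm : Measurable (fun x => (⟨cdf ν x, cdf_nonneg ν x, cdf_le_one ν x⟩ : I)) :=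
    (hc.subtype_mk _).measurable
  have : IsProbabilityMeasure (ν.map (fun x => (⟨cdf ν x, cdf_nonneg ν x, cdf_le_one ν x⟩ : I))) :=
    Measure.isProbabilityMeasure_map hm.aemeasurable
  refine Measure.ext_of_Iic _ _ fun a => ?_
  rw [Measure.map_apply hm measurableSet_Iic, unitInterval.volume_Iic]
  set S : Set ℝ := {x | cdf ν x ≤ a} with hS
  change ν S = _
  -- The value `a = 1` is separate because the sublevel set is then all of `ℝ` and has no supremum.
  rcases eq_or_lt_of_le a.2.2 with ha | ha
  · have : S = univ := by
      ext x; simp [hS, ha, cdf_le_one]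
    simp [this, ha]
  have hScl : IsClosed S := isClosed_le hc continuous_const
  rcases S.eq_empty_or_nonempty with hE | hne
  · rw [hE, measure_empty, eq_comm, ENNReal.ofReal_eq_zero]
    refine ge_of_tendsto (tendsto_cdf_atBot ν) (Eventually.of_forall fun x => ?_)
    have : x ∉ S := by simp [hE]
    exact (not_le.1 this).le
  have hbdd : BddAbove S := by
    obtain ⟨b, hb⟩ := ((tendsto_cdf_atTop ν).eventually (eventually_gt_nhds ha)).exists
    exact ⟨b, fun x hx => not_lt.1 fun h => (hb.trans_le (monotone_cdf ν h.le)).not_ge hx⟩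
  have hmem : sSup S ∈ S := hScl.csSup_mem hne hbdd
  have hSeq : S = Iic (sSup S) := by
    ext x
    exact ⟨fun hx => le_csSup hbdd hx, fun hx => (monotone_cdf ν hx).trans hmem⟩
  rw [hSeq, ← ofReal_cdf]
  congr 1
  -- To the right of `sSup S` the cdf exceeds `a`; continuity gives equality at the supremum.
  refine le_antisymm hmem ?_
  refine ge_of_tendsto (hc.continuousAt.continuousWithinAt (s := Ioi (sSup S)))
    (eventually_nhdsWithin_of_forall fun y hy => ?_)
  exact (not_le.1 fun h : cdf ν y ≤ a => (le_csSup hbdd h).not_gt hy).le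

/-- An atomless finite measure on a standard Borel space can be transported to any finite measure
of the same mass on a standard Borel space. -/
theorem exists_measurable_map_eq_of_atomless {X Y : Type*} [MeasurableSpace X]
    [StandardBorelSpace X] [MeasurableSpace Y] [StandardBorelSpace Y] [Nonempty Y]
    (μ : Measure X) [IsFiniteMeasure μ] (hμ : ∀ x, μ {x} = 0) (ν : Measure Y)
    (hmass : μ univ = ν univ) : ∃ T : X → Y, Measurable T ∧ μ.map T = ν := by
  by_cases h0 : μ = 0
  · refine ⟨fun _ => Classical.arbitrary Y, measurable_const, ?_⟩
    have : ν = 0 := by rw [← Measure.measure_univ_eq_zero, ← hmass, h0]; simp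
    simp [this, h0]
  have hne : μ univ ≠ 0 := by simpa using h0
  have htop : μ univ ≠ ⊤ := measure_ne_top _ _
  wlog hprob : μ univ = 1 generalizing μ ν
  · obtain ⟨T, hT, hmap⟩ := this ((μ univ)⁻¹ • μ) (by simp [hμ]) ((μ univ)⁻¹ • ν)
      (by simp [hmass]) (by simp [h0, htop])
      (by simp [ENNReal.inv_mul_cancel hne htop]) (by simp [ENNReal.inv_mul_cancel hne htop])
      (by simp [ENNReal.inv_mul_cancel hne htop])
    refine ⟨T, hT, ?_⟩
    rw [Measure.map_smul] at hmap
    have := congrArg (fun m => μ univ • m) hmap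
    simpa [smul_smul, ENNReal.mul_inv_cancel hne htop] using this
  have : IsProbabilityMeasure μ := ⟨hprob⟩
  have : IsProbabilityMeasure ν := ⟨by rw [← hmass, hprob]⟩
  have he := measurableEmbedding_embeddingReal X
  have hatom : ∀ x, (μ.map (embeddingReal X)) {x} = 0 := fun x => by
    rw [Measure.map_apply he.measurable (measurableSet_singleton x)]
    have hsub := subsingleton_singleton.preimage he.injective (s := {x})
    rcases hsub.eq_empty_or_singleton with h | ⟨y, h⟩
    · simp [h]
    · rw [h, hμ]
  have : IsProbabilityMeasure (μ.map (embeddingReal X)) :=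
    Measure.isProbabilityMeasure_map he.measurable.aemeasurable
  -- `f` realises `ν` as an image of Lebesgue measure on `I`; that Lebesgue measure is obtained from
  -- `μ` by embedding `X` in `ℝ` and applying the cdf.
  obtain ⟨f, hf, hfν⟩ := ν.exists_measurable_map_eq
  have hF := map_cdf_eq_volume _ hatom
  set F : ℝ → I := fun x => ⟨cdf (μ.map (embeddingReal X)) x, cdf_nonneg _ x, cdf_le_one _ x⟩
  have hFm : Measurable F := ((continuous_cdf_of_atomless _ hatom).subtype_mk _).measurable
  refine ⟨f ∘ F ∘ embeddingReal X, by have := he.measurable; fun_prop, ?_⟩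
  rw [← Measure.map_map hf (hFm.comp he.measurable), ← Measure.map_map hFm he.measurable, hF, hfν]

/-- A measure is the sum of its restrictions to the fibres of a countably valued map. -/
theorem sum_restrict_fibers {X : Type*} [MeasurableSpace X] (μ : Measure X) {p : X → ℕ}
    (hp : Measurable p) : Measure.sum (fun j => μ.restrict (p ⁻¹' {j})) = μ := by
  rw [← Measure.restrict_iUnion (fun i j hij => Disjoint.preimage p (by simpa using hij))
    fun j => hp (measurableSet_singleton j)]
  have : ⋃ j, p ⁻¹' {j} = univ := by ext x; simp
  rw [this, Measure.restrict_univ]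

/-- A transport map from an atomless measure can be chosen compatible with countable measurable
partitions of the source and of the target whose cells have matching masses. -/
theorem exists_measurable_map_eq_of_atomless_of_partition {X Y : Type*} [MeasurableSpace X]
    [StandardBorelSpace X] [MeasurableSpace Y] [StandardBorelSpace Y] [Nonempty Y]
    (μ : Measure X) [IsFiniteMeasure μ] (hμ : ∀ x, μ {x} = 0) (ν : Measure Y)
    {p : X → ℕ} {q : Y → ℕ} (hp : Measurable p) (hq : Measurable q)
    (hpq : μ.map p = ν.map q) :
    ∃ T : X → Y, Measurable T ∧ μ.map T = ν ∧ ∀ᵐ x ∂μ, q (T x) = p x := by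
  have hpj : ∀ j, MeasurableSet (p ⁻¹' {j}) := fun j => hp (measurableSet_singleton j)
  have hqj : ∀ j, MeasurableSet (q ⁻¹' {j}) := fun j => hq (measurableSet_singleton j)
  have hex : ∀ j, ∃ T : X → Y, Measurable T ∧
      (μ.restrict (p ⁻¹' {j})).map T = ν.restrict (q ⁻¹' {j}) := fun j => by
    refine exists_measurable_map_eq_of_atomless _
      (fun x => le_antisymm ((Measure.restrict_apply_le _ _).trans (hμ x).le) zero_le) _ ?_
    rw [Measure.restrict_apply_univ, Measure.restrict_apply_univ,
      ← Measure.map_apply hp (measurableSet_singleton j),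
      ← Measure.map_apply hq (measurableSet_singleton j), hpq]
  choose T hT hmap using hex
  have hTm : Measurable fun x => T (p x) x :=
    (measurable_from_prod_countable_right (f := fun z : ℕ × X => T z.1 z.2) hT).comp
      (hp.prodMk measurable_id)
  have hcell : ∀ j, (μ.restrict (p ⁻¹' {j})).map (fun x => T (p x) x)
      = ν.restrict (q ⁻¹' {j}) := fun j => by
    rw [← hmap j]
    refine Measure.map_congr ?_
    filter_upwards [ae_restrict_mem (hpj j)] with x hx
    rw [show p x = j from hx]
  refine ⟨fun x => T (p x) x, hTm, ?_, ?_⟩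
  · rw [← sum_restrict_fibers μ hp, Measure.map_sum hTm.aemeasurable]
    simp_rw [hcell]
    exact sum_restrict_fibers ν hq
  · rw [← sum_restrict_fibers μ hp, Measure.ae_sum_iff]
    intro j
    have h1 : ∀ᵐ y ∂((μ.restrict (p ⁻¹' {j})).map (fun x => T (p x) x)), q y = j := by
      rw [hcell]; exact ae_restrict_mem (hqj j)
    filter_upwards [ae_of_ae_map hTm.aemeasurable h1, ae_restrict_mem (hpj j)] with x hx hx'
    rw [hx, show p x = j from hx']

/-! ### Weak derivatives -/

/-- Integrals over the unit interval as interval integrals. -/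
theorem integral_unitInterval {E : Type*} [NormedAddCommGroup E] [NormedSpace ℝ E] (F : ℝ → E) :
    ∫ s : I, F s = ∫ x in (0 : ℝ)..1, F x := by
  rw [unitInterval.measurePreserving_coe.integral_comp unitInterval.measurableEmbedding_coe F,
    intervalIntegral.integral_of_le zero_le_one, ← integral_Icc_eq_integral_Ioc]

/-- Test functions on `(0,1)`. -/
structure TestFunction where
  /-- The underlying function. -/
  toFun : ℝ → ℝ
  contDiff : ContDiff ℝ ∞ toFun
  hasCompactSupport : HasCompactSupport toFun
  tsupport_subset : tsupport toFun ⊆ Ioo (0 : ℝ) 1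

namespace TestFunction

variable (ψ : TestFunction)

theorem continuous : Continuous ψ.toFun := ψ.contDiff.continuous

theorem continuous_deriv : Continuous (deriv ψ.toFun) :=
  ψ.contDiff.continuous_deriv (by simp)

theorem hasDerivAt (x : ℝ) : HasDerivAt ψ.toFun (deriv ψ.toFun x) x :=
  (ψ.contDiff.differentiable (by simp) x).hasDerivAt

theorem eq_zero_of_notMem {x : ℝ} (hx : x ∉ Ioo (0 : ℝ) 1) : ψ.toFun x = 0 :=
  image_eq_zero_of_notMem_tsupport fun h => hx (ψ.tsupport_subset h)

/-- The restriction of a test function to the unit interval. -/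
def restrict : C(I, ℝ) := ⟨fun s => ψ.toFun s, ψ.continuous.comp continuous_subtype_val⟩

/-- The restriction of the derivative of a test function to the unit interval. -/
def derivRestrict : C(I, ℝ) :=
  ⟨fun s => deriv ψ.toFun s, ψ.continuous_deriv.comp continuous_subtype_val⟩

end TestFunction

theorem isWeakDeriv_iff_forall_testFunction {f g : I → Rd d} :
    IsWeakDeriv f g ↔ ∀ ψ : TestFunction,
      ∫ s, ψ.derivRestrict s • f s = - ∫ s, ψ.restrict s • g s :=
  ⟨fun h ψ => h _ ψ.contDiff ψ.hasCompactSupport ψ.tsupport_subset,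
    fun h ψ h1 h2 h3 => h ⟨ψ, h1, h2, h3⟩⟩

theorem IsWeakDeriv.congr_ae {f f' g g' : I → Rd d} (h : IsWeakDeriv f g)
    (hf : f =ᵐ[volume] f') (hg : g =ᵐ[volume] g') : IsWeakDeriv f' g' := by
  intro ψ h1 h2 h3
  have e1 : ∫ s : I, deriv ψ s • f' s = ∫ s : I, deriv ψ s • f s :=
    integral_congr_ae (by filter_upwards [hf] with s hs; rw [hs])
  have e2 : ∫ s : I, ψ s • g' s = ∫ s : I, ψ s • g s :=
    integral_congr_ae (by filter_upwards [hg] with s hs; rw [hs])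
  rw [e1, e2, h ψ h1 h2 h3]

/-- Continuously differentiable functions have their derivative as weak derivative. -/
theorem isWeakDeriv_of_hasDerivAt {f f' : ℝ → Rd d} (hf : ∀ x, HasDerivAt f (f' x) x)
    (hf' : Continuous f') : IsWeakDeriv (fun s : I => f s) (fun s : I => f' s) := by
  rw [isWeakDeriv_iff_forall_testFunction]
  intro ψ
  have hfc : Continuous f := continuous_iff_continuousAt.2 fun x => (hf x).continuousAt
  have e1 := integral_unitInterval fun x => deriv ψ.toFun x • f x
  have e2 := integral_unitInterval fun x => ψ.toFun x • f' x
  change ∫ s : I, deriv ψ.toFun s • f s = - ∫ s : I, ψ.toFun s • f' s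
  rw [e1, e2, intervalIntegral.integral_smul_deriv_eq_deriv_smul
    (fun x _ => ψ.hasDerivAt x) (fun x _ => hf x)
    (ψ.continuous_deriv.intervalIntegrable _ _) (hf'.intervalIntegrable _ _),
    ψ.eq_zero_of_notMem (by simp), ψ.eq_zero_of_notMem (by simp)]
  simp

/-- The primitive of an integrable function is continuous. -/
theorem continuous_primitive_unitInterval {g : I → Rd d} (hg : Integrable g) :
    Continuous fun r : I => ∫ s, (Iic r).indicator g s := by
  refine continuous_iff_continuousAt.2 fun r₀ => ?_
  refine continuousAt_of_dominated (bound := fun s => ‖g s‖)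
    (Eventually.of_forall fun r => (hg.indicator measurableSet_Iic).aestronglyMeasurable)
    (Eventually.of_forall fun r => Eventually.of_forall fun s => norm_indicator_le_norm_self _ _)
    hg.norm ?_
  have hne : ∀ᵐ s : I, s ≠ r₀ := by
    simp [ae_iff]
  filter_upwards [hne] with s hs
  rcases lt_or_gt_of_ne hs with h | h
  · refine (continuousAt_const (y := g s)).congr ?_
    filter_upwards [eventually_gt_nhds h] with r hr
    rw [indicator_of_mem (show s ∈ Iic r from le_of_lt hr)]
  · refine (continuousAt_const (y := (0 : Rd d))).congr ?_
    filter_upwards [eventually_lt_nhds h] with r hr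
    rw [indicator_of_notMem (show s ∉ Iic r from not_le.2 hr)]

/-- An integrable function is the weak derivative of its primitive. -/
theorem isWeakDeriv_primitive {g : I → Rd d} (hg : Integrable g) :
    IsWeakDeriv (fun r => ∫ s, (Iic r).indicator g s) g := by
  rw [isWeakDeriv_iff_forall_testFunction]
  intro ψ
  -- The constraint `s ≤ r` is read as a condition on `r`, so that after Fubini the inner integral
  -- is `ψ 1 - ψ s = -ψ s`.
  have hind : ∀ r s : I, ψ.derivRestrict r • (Iic r).indicator g s
      = (Ici s).indicator ψ.derivRestrict r • g s := fun r s => by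
    by_cases h : s ≤ r <;> simp [indicator, h]
  have hint : Integrable (Function.uncurry fun r s : I =>
      (Ici s).indicator ψ.derivRestrict r • g s) (volume.prod volume) := by
    have h1 : Integrable (fun z : I × I => ψ.derivRestrict z.1 • g z.2)
        (volume.prod volume) :=
      (ψ.derivRestrict.continuous.integrable_of_hasCompactSupport
        (HasCompactSupport.of_compactSpace _)).smul_prod hg
    have h2 : MeasurableSet {z : I × I | z.2 ≤ z.1} := measurableSet_le measurable_snd measurable_fst
    refine (h1.indicator h2).congr (Eventually.of_forall fun z => ?_)
    by_cases h : z.2 ≤ z.1 <;> simp [indicator, h, Function.uncurry]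
  have hinner : ∀ s : I, ∫ r : I, (Ici s).indicator ψ.derivRestrict r = - ψ.restrict s := fun s => by
    have e1 := integral_unitInterval fun x => (Ici (s : ℝ)).indicator (deriv ψ.toFun) x
    have e2 : ∫ r : I, (Ici s).indicator ψ.derivRestrict r
        = ∫ r : I, (Ici (s : ℝ)).indicator (deriv ψ.toFun) r := rfl
    rw [e2, e1, intervalIntegral.integral_of_le zero_le_one, ← integral_Icc_eq_integral_Ioc,
      setIntegral_indicator measurableSet_Ici]
    have : Icc (0 : ℝ) 1 ∩ Ici (s : ℝ) = Icc (s : ℝ) 1 := by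
      ext x; simp only [mem_inter_iff, mem_Icc, mem_Ici]; have := s.2.1; grind
    rw [this, integral_Icc_eq_integral_Ioc, ← intervalIntegral.integral_of_le s.2.2,
      intervalIntegral.integral_eq_sub_of_hasDerivAt (fun x _ => ψ.hasDerivAt x)
        (ψ.continuous_deriv.intervalIntegrable _ _), ψ.eq_zero_of_notMem (x := 1) (by simp)]
    simp [TestFunction.restrict]
  simp_rw [← integral_smul, hind]
  rw [integral_integral_swap hint]
  simp_rw [integral_smul_const, hinner, neg_smul]
  exact integral_neg _

/-- Weak derivatives are unique. -/
theorem IsWeakDeriv.unique {f : I → Rd d} {u v : L2Path d} (hu : IsWeakDeriv f u)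
    (hv : IsWeakDeriv f v) : u = v := by
  have hui : Integrable (u : I → Rd d) := (Lp.memLp u).integrable (by norm_num)
  have hvi : Integrable (v : I → Rd d) := (Lp.memLp v).integrable (by norm_num)
  set w : I → Rd d := fun s => u s - v s with hw
  have hwi : Integrable w := hui.sub hvi
  -- Extending the difference to `ℝ` permits the fundamental lemma of the calculus of variations on
  -- the open interval; the endpoints are null.
  set W : ℝ → Rd d := fun x => w (projIcc 0 1 zero_le_one x) with hW
  have hWw : ∀ s : I, W s = w s := fun s => by simp [hW]
  have hWi : IntegrableOn W (Icc 0 1) := by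
    have := (unitInterval.measurePreserving_coe.integrable_comp_emb
      unitInterval.measurableEmbedding_coe (g := W)).1 (by simpa [Function.comp_def, hWw] using hwi)
    exact this
  have key : ∀ᵐ x : ℝ, x ∈ Ioo (0 : ℝ) 1 → W x = 0 := by
    refine isOpen_Ioo.ae_eq_zero_of_integral_contDiff_smul_eq_zero
      ((hWi.mono_set Ioo_subset_Icc_self).locallyIntegrableOn) fun ψ h1 h2 h3 => ?_
    have e : ∫ x, ψ x • W x = ∫ s : I, ψ s • w s := by
      have e1 := unitInterval.measurePreserving_coe.integral_comp
        unitInterval.measurableEmbedding_coe (fun x => ψ x • W x)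
      simp only [hWw] at e1
      rw [e1]
      refine (setIntegral_eq_integral_of_forall_compl_eq_zero fun x hx => ?_).symm
      rw [image_eq_zero_of_notMem_tsupport fun h => hx (Ioo_subset_Icc_self (h3 h)), zero_smul]
    have hψ : ∀ {z : I → Rd d}, Integrable z → Integrable (fun s : I => ψ s • z s) := fun hz =>
      integrableOn_univ.1 ((integrableOn_univ.2 hz).continuousOn_smul
        (h1.continuous.comp continuous_subtype_val).continuousOn isCompact_univ)
    rw [e]
    simp_rw [hw, smul_sub]
    rw [integral_sub (hψ hui) (hψ hvi), sub_eq_zero]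
    have := (hu ψ h1 h2 h3).symm.trans (hv ψ h1 h2 h3)
    exact neg_injective this
  refine Lp.ext ?_
  have key2 : ∀ᵐ s : I, (s : ℝ) ∈ Ioo (0 : ℝ) 1 → W s = 0 :=
    unitInterval.measurePreserving_coe.quasiMeasurePreserving.ae (ae_restrict_of_ae key)
  have h0 : ∀ᵐ s : I, s ≠ 0 := by simp [ae_iff]
  have h1 : ∀ᵐ s : I, s ≠ 1 := by simp [ae_iff]
  filter_upwards [key2, h0, h1] with s hs hs0 hs1
  have := hs ⟨unitInterval.pos_iff_ne_zero.2 hs0, unitInterval.lt_one_iff_ne_one.2 hs1⟩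
  rw [hWw] at this
  exact sub_eq_zero.1 this

/-! ### The path space as a closed subspace -/

/-- The pairing `u ↦ ∫ ψ u` of square integrable paths with a continuous function. -/
def pairing (ψ : C(I, ℝ)) : L2Path d →L[ℝ] Rd d :=
  (ContinuousLinearMap.lsmul ℝ ℝ).lpPairing volume 2 2 (ContinuousMap.toLp 2 volume ℝ ψ)

theorem pairing_apply (ψ : C(I, ℝ)) (u : L2Path d) : pairing ψ u = ∫ s, ψ s • u s := by
  rw [pairing, ContinuousLinearMap.lpPairing_eq_integral]
  refine integral_congr_ae ?_
  filter_upwards [ContinuousMap.coeFn_toLp (p := 2) (𝕜 := ℝ) volume ψ] with s hs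
  rw [hs, ContinuousLinearMap.lsmul_apply]

/-- The ambient space `C⁰ × L² × L²` of the path space. -/
abbrev Ambient (d : ℕ) : Type := C(I, Rd d) × L2Path d × L2Path d

/-- The defect in the weak derivative relation against a test function. -/
def weakDefect (ψ : TestFunction) : L2Path d × L2Path d →L[ℝ] Rd d :=
  (pairing ψ.derivRestrict).coprod (pairing ψ.restrict)

theorem isWeakDeriv_iff_weakDefect {u v : L2Path d} :
    IsWeakDeriv u v ↔ ∀ ψ, weakDefect ψ (u, v) = 0 := by
  simp only [isWeakDeriv_iff_forall_testFunction, weakDefect, ContinuousLinearMap.coprod_apply,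
    pairing_apply, eq_neg_iff_add_eq_zero]

/-- The pair of a path and its first derivative, as square integrable functions. -/
def lowerPair : Ambient d →L[ℝ] L2Path d × L2Path d :=
  ((ContinuousMap.toLp 2 volume ℝ).prodMap (ContinuousLinearMap.fst ℝ (L2Path d) (L2Path d)))

/-- The Sobolev space `H²` as a subspace of `C⁰ × L² × L²`. -/
def sobolev (d : ℕ) : Submodule ℝ (Ambient d) :=
  ⨅ ψ : TestFunction, LinearMap.ker (weakDefect ψ ∘L lowerPair).toLinearMap ⊓
    LinearMap.ker (weakDefect ψ ∘L ContinuousLinearMap.snd ℝ _ _).toLinearMap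

theorem mem_sobolev_iff {p : Ambient d} : p ∈ sobolev d ↔
    IsWeakDeriv (fun s => p.1 s) (fun s => p.2.1 s) ∧
      IsWeakDeriv (fun s => p.2.1 s) (fun s => p.2.2 s) := by
  have hae := ContinuousMap.coeFn_toLp (p := 2) (𝕜 := ℝ) volume p.1
  have h1 : IsWeakDeriv (fun s => p.1 s) (fun s => p.2.1 s) ↔
      IsWeakDeriv (ContinuousMap.toLp 2 volume ℝ p.1 : L2Path d) p.2.1 :=
    ⟨fun h => h.congr_ae hae.symm .rfl, fun h => h.congr_ae hae .rfl⟩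
  rw [h1, isWeakDeriv_iff_weakDefect, isWeakDeriv_iff_weakDefect, ← forall_and]
  simp only [sobolev, Submodule.mem_iInf, Submodule.mem_inf, LinearMap.mem_ker]
  rfl

/-- Closedness makes the path space complete, for the open mapping theorem, and Polish, for the
transport results. -/
theorem isClosed_sobolev : IsClosed (sobolev d : Set (Ambient d)) := by
  simp only [sobolev, Submodule.coe_iInf, Submodule.coe_inf]
  exact isClosed_iInter fun ψ => (ContinuousLinearMap.isClosed_ker _).inter
    (ContinuousLinearMap.isClosed_ker _)

instance : CompleteSpace (sobolev d) := isClosed_sobolev.completeSpace_coe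

/-- An element of the Sobolev subspace as a path. -/
def toPath (w : sobolev d) : H2Path d := ⟨w.1, mem_sobolev_iff.1 w.2⟩

/-- A path as an element of the Sobolev subspace. -/
def ofPath (x : H2Path d) : sobolev d := ⟨x.1, mem_sobolev_iff.2 x.2⟩

@[simp] theorem toPath_ofPath (x : H2Path d) : toPath (ofPath x) = x := rfl

@[simp] theorem ofPath_toPath (w : sobolev d) : ofPath (toPath w) = w := rfl

theorem continuous_toPath : Continuous (toPath : sobolev d → H2Path d) :=
  continuous_subtype_val.subtype_mk _

theorem continuous_ofPath : Continuous (ofPath : H2Path d → sobolev d) :=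
  Continuous.subtype_mk (continuous_subtype_val (p := fun p : Ambient d =>
    IsWeakDeriv (fun s => p.1 s) (fun s => p.2.1 s) ∧
      IsWeakDeriv (fun s => p.2.1 s) (fun s => p.2.2 s))) _

/-- The path space is homeomorphic to the Sobolev subspace. -/
def pathHomeomorph : H2Path d ≃ₜ sobolev d where
  toFun := ofPath
  invFun := toPath
  left_inv := toPath_ofPath
  right_inv := ofPath_toPath
  continuous_toFun := continuous_ofPath
  continuous_invFun := continuous_toPath

theorem polishSpace_prod {α β : Type*} [TopologicalSpace α] [TopologicalSpace β] [PolishSpace α]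
    [PolishSpace β] : PolishSpace (α × β) := inferInstance

instance : PolishSpace (H2Path d) := by
  have : Fact ((2 : ℝ≥0∞) ≠ ⊤) := ⟨by norm_num⟩
  have h1 : PolishSpace (L2Path d) := inferInstance
  have h2 : PolishSpace C(I, Rd d) := inferInstance
  have h3 : PolishSpace (L2Path d × L2Path d) := polishSpace_prod
  have h4 : PolishSpace (Ambient d) := polishSpace_prod
  have : PolishSpace (sobolev d) := isClosed_sobolev.polishSpace
  exact pathHomeomorph.isClosedEmbedding.polishSpace

instance : Nonempty (H2Path d) := ⟨toPath 0⟩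

/-- A path is determined by its values. -/
theorem eq_of_forall_eval_eq {x y : H2Path d} (h : ∀ s, eval s x = eval s y) : x = y := by
  obtain ⟨⟨x0, x1, x2⟩, hx1, hx2⟩ := x
  obtain ⟨⟨y0, y1, y2⟩, hy1, hy2⟩ := y
  obtain rfl : x0 = y0 := ContinuousMap.ext h
  obtain rfl : x1 = y1 := hx1.unique hy1
  obtain rfl : x2 = y2 := hx2.unique hy2
  rfl

/-- The evaluations at a dense sequence of times generate the Borel sets of the path space. -/
theorem measurableEmbedding_eval_denseSeq : MeasurableEmbedding
    fun (x : H2Path d) (k : ℕ) => eval (TopologicalSpace.denseSeq I k) x := by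
  -- Lusin–Souslin: a continuous injection of a Polish space is a Borel embedding.
  refine Continuous.measurableEmbedding (continuous_pi fun k => continuous_eval _) fun x y hxy => ?_
  refine eq_of_forall_eval_eq fun s => congrFun (?_ : (fun s => eval s x) = fun s => eval s y) s
  refine Continuous.ext_on (TopologicalSpace.denseRange_denseSeq I) x.1.1.continuous
    y.1.1.continuous ?_
  rintro _ ⟨k, rfl⟩
  exact congrFun hxy k

/-- A path-valued map is Borel as soon as all its evaluations are. -/
theorem measurable_of_forall_measurable_eval {X : Type*} [MeasurableSpace X] {φ : X → H2Path d}
    (h : ∀ s, Measurable fun x => eval s (φ x)) : Measurable φ :=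
  measurableEmbedding_eval_denseSeq.measurable_comp_iff.1 (measurable_pi_iff.2 fun _ => h _)

theorem energy_eq (x : H2Path d) : energy x = ‖acc x‖ₑ ^ 2 := by
  rw [Lp.enorm_def, eLpNorm_eq_lintegral_rpow_enorm_toReal (by norm_num) (by norm_num)]
  simp only [ENNReal.toReal_ofNat, ENNReal.rpow_ofNat, one_div]
  rw [← ENNReal.rpow_natCast, ← ENNReal.rpow_mul]
  simp [energy]

theorem energy_eq_coe (x : H2Path d) : energy x = ((‖acc x‖₊ ^ 2 : NNReal) : ℝ≥0∞) := by
  rw [energy_eq, ENNReal.coe_pow]; rfl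

theorem continuous_acc : Continuous (acc : H2Path d → L2Path d) :=
  continuous_snd.comp (continuous_snd.comp
    ((continuous_subtype_val (p := (· ∈ sobolev d))).comp continuous_ofPath))

theorem continuous_energy : Continuous (energy : H2Path d → ℝ≥0∞) := by
  rw [funext energy_eq]
  exact (ENNReal.continuous_pow 2).comp continuous_acc.enorm

/-- The second derivative on the Sobolev subspace. -/
def accL : sobolev d →L[ℝ] L2Path d :=
  ContinuousLinearMap.snd ℝ _ _ ∘L ContinuousLinearMap.snd ℝ _ _ ∘L (sobolev d).subtypeL

/-- Evaluation on the Sobolev subspace. -/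
def evalL (s : I) : sobolev d →L[ℝ] Rd d :=
  ContinuousMap.evalCLM ℝ s ∘L ContinuousLinearMap.fst ℝ _ _ ∘L (sobolev d).subtypeL

/-- Every square integrable function is the acceleration of a path. -/
theorem accL_surjective : Function.Surjective (accL : sobolev d → L2Path d) := fun u => by
  have hu : Integrable (u : I → Rd d) := (Lp.memLp u).integrable (by norm_num)
  let v : C(I, Rd d) := ⟨_, continuous_primitive_unitInterval hu⟩
  have hv : Integrable v := v.continuous.integrable_of_hasCompactSupport
    (HasCompactSupport.of_compactSpace _)
  let x : C(I, Rd d) := ⟨_, continuous_primitive_unitInterval hv⟩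
  have hae := ContinuousMap.coeFn_toLp (p := 2) (𝕜 := ℝ) volume v
  exact ⟨⟨(x, ContinuousMap.toLp 2 volume ℝ v, u), mem_sobolev_iff.2
    ⟨(isWeakDeriv_primitive hv).congr_ae .rfl hae.symm,
      (isWeakDeriv_primitive hu).congr_ae hae.symm .rfl⟩⟩, rfl⟩

/-- The products of a scalar polynomial with vectors are paths, linearly in the vector. -/
theorem exists_path_polynomial (p : Polynomial ℝ) :
    ∃ R : Rd d →L[ℝ] sobolev d, ∀ s v, evalL s (R v) = p.eval (s : ℝ) • v := by
  have hex : ∀ v : Rd d, ∃ w : sobolev d, ∀ s, evalL s w = p.eval (s : ℝ) • v := fun v => by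
    let f : Polynomial ℝ → C(I, Rd d) := fun q => ⟨fun s => q.eval (s : ℝ) • v, by fun_prop⟩
    have hf : ∀ q, IsWeakDeriv (fun s => f q s) (fun s => f q.derivative s) := fun q =>
      isWeakDeriv_of_hasDerivAt (f := fun x => q.eval x • v)
        (fun x => (q.hasDerivAt x).smul_const v) (by fun_prop)
    have hae := fun q => ContinuousMap.coeFn_toLp (p := 2) (𝕜 := ℝ) volume (f q)
    exact ⟨⟨(f p, ContinuousMap.toLp 2 volume ℝ (f p.derivative),
      ContinuousMap.toLp 2 volume ℝ (f p.derivative.derivative)), mem_sobolev_iff.2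
      ⟨(hf p).congr_ae .rfl (hae _).symm, (hf _).congr_ae (hae _).symm (hae _).symm⟩⟩,
      fun s => rfl⟩
  choose w hw using hex
  -- The choice `w` need not be linear, so it is kept on a basis only and extended linearly.
  let b := Module.finBasis ℝ (Rd d)
  refine ⟨LinearMap.toContinuousLinearMap (b.constr ℝ fun i => w (b i)), fun s v => ?_⟩
  have : (evalL s).toLinearMap ∘ₗ (b.constr ℝ fun i => w (b i)) = p.eval (s : ℝ) • LinearMap.id := by
    refine b.ext fun i => ?_
    simp [hw]
  exact LinearMap.congr_fun this v

/-! ### Minimal interpolation -/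

/-- Evaluation at finitely many times. -/
def evalAllL {n : ℕ} (t : Fin n → I) : sobolev d →L[ℝ] (Fin n → Rd d) :=
  ContinuousLinearMap.pi fun i => evalL (t i)

theorem evalAllL_sub {n : ℕ} (t : Fin n → I) (w z : sobolev d) :
    evalAllL t (w - z) = evalAllL t w - evalAllL t z := rfl

theorem accL_sub (w z : sobolev d) : accL (w - z) = accL w - accL z := rfl

theorem evalAllL_surjective {n : ℕ} {t : Fin n → I} (ht : Function.Injective t) :
    Function.Surjective (evalAllL t : sobolev d → Fin n → Rd d) := fun y => by
  choose R hR using fun i => exists_path_polynomial (d := d)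
    (Lagrange.basis Finset.univ (fun i => (t i : ℝ)) i)
  have hinj : Set.InjOn (fun i => (t i : ℝ)) (Finset.univ : Finset (Fin n)) :=
    (Subtype.val_injective.comp ht).injOn
  refine ⟨∑ i, R i (y i), funext fun j => ?_⟩
  change evalL (t j) (∑ i, R i (y i)) = y j
  rw [map_sum, Finset.sum_eq_single j]
  · rw [hR, Lagrange.eval_basis_self hinj (Finset.mem_univ j), one_smul]
  · intro i _ hij
    rw [hR, Lagrange.eval_basis_of_ne (v := fun i => (t i : ℝ)) hij (Finset.mem_univ j), zero_smul]
  · simp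

/-- The accelerations of the paths vanishing at given times. -/
def vanishingAcc {n : ℕ} (t : Fin n → I) : Submodule ℝ (L2Path d) :=
  (LinearMap.ker (evalAllL t).toLinearMap).map (accL (d := d)).toLinearMap

theorem isClosed_of_submodule {V : Type*} [NormedAddCommGroup V] [NormedSpace ℝ V]
    [FiniteDimensional ℝ V] (S : Submodule ℝ V) : IsClosed (S : Set V) :=
  S.closed_of_finiteDimensional

/-- Needed for the orthogonal projection. By the open mapping theorem `accL` is a quotient map, so
it suffices that the preimage `ker evalAllL + ker accL` is closed. This is also the preimage under
`evalAllL` of a subspace of a finite-dimensional space. -/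
theorem isClosed_vanishingAcc {n : ℕ} (t : Fin n → I) :
    IsClosed ((vanishingAcc t : Submodule ℝ (L2Path d)) : Set (L2Path d)) := by
  have ho : IsOpenMap (accL : sobolev d → L2Path d) :=
    @ContinuousLinearMap.isOpenMap ℝ ℝ _ _ (RingHom.id ℝ) (sobolev d) _ _ (L2Path d) _ _ accL
      (RingHom.id ℝ) _ _ _ _ _ accL_surjective
  have hq := ho.isQuotientMap accL.continuous accL_surjective
  rw [← hq.isClosed_preimage]
  have : (accL (d := d)) ⁻¹' ((vanishingAcc t : Submodule ℝ (L2Path d)) : Set (L2Path d)) = evalAllL t ⁻¹'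
      ((LinearMap.ker (accL (d := d)).toLinearMap).map (evalAllL t).toLinearMap :
        Submodule ℝ (Fin n → Rd d)) := by
    ext w
    constructor
    · rintro ⟨z, hz, hzw⟩
      refine ⟨w - z, ?_, ?_⟩
      · change accL (w - z) = 0
        rw [accL_sub, sub_eq_zero]; exact hzw.symm
      · change evalAllL t (w - z) = evalAllL t w
        rw [evalAllL_sub, show evalAllL t z = 0 from hz, sub_zero]
    · rintro ⟨z, hz, hzw⟩
      refine ⟨w - z, ?_, ?_⟩
      · change evalAllL t (w - z) = 0
        rw [evalAllL_sub, sub_eq_zero]; exact hzw.symm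
      · change accL (w - z) = accL w
        rw [accL_sub, show accL z = 0 from hz, sub_zero]
  rw [this]
  exact (isClosed_of_submodule _).preimage (evalAllL t).continuous

/-- Interpolating paths can be chosen with acceleration orthogonal to the accelerations of the
paths vanishing at the interpolation times. -/
theorem exists_interpolation_orthogonal {n : ℕ} {t : Fin n → I} (ht : Function.Injective t)
    (y : Fin n → Rd d) :
    ∃ w : sobolev d, evalAllL t w = y ∧ accL w ∈ (vanishingAcc t : Submodule ℝ (L2Path d))ᗮ := by
  have : CompleteSpace (vanishingAcc t : Submodule ℝ (L2Path d)) :=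
    (isClosed_vanishingAcc t).completeSpace_coe
  obtain ⟨w, rfl⟩ := evalAllL_surjective ht y
  obtain ⟨z, hz, hzw⟩ := (vanishingAcc t : Submodule ℝ (L2Path d)).starProjection_apply_mem (accL w)
  refine ⟨w - z, ?_, ?_⟩
  · rw [evalAllL_sub, show evalAllL t z = 0 from hz, sub_zero]
  · rw [accL_sub, show accL z = _ from hzw]
    exact Submodule.sub_starProjection_mem_orthogonal _

/-- There is a continuous linear choice of an interpolating path of least energy. -/
theorem exists_minimal_interpolation {n : ℕ} {t : Fin n → I} (ht : Function.Injective t) :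
    ∃ Φ : (Fin n → Rd d) →L[ℝ] sobolev d, (∀ y i, evalL (t i) (Φ y) = y i) ∧
      ∀ w : sobolev d, ‖accL (Φ (evalAllL t w))‖ ≤ ‖accL w‖ := by
  choose m hm hmo using exists_interpolation_orthogonal (d := d) ht
  -- Interpolation and orthogonality are linear conditions, so both survive linear extension from a
  -- basis.
  let b := Module.finBasis ℝ (Fin n → Rd d)
  let Φ := LinearMap.toContinuousLinearMap (b.constr ℝ fun i => m (b i))
  have hΦ : ∀ y, evalAllL t (Φ y) = y := fun y => by
    have : (evalAllL t).toLinearMap ∘ₗ (b.constr ℝ fun i => m (b i)) = LinearMap.id :=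
      b.ext fun i => by simp [hm]
    exact LinearMap.congr_fun this y
  have hΦo : ∀ y, accL (Φ y) ∈ (vanishingAcc t : Submodule ℝ (L2Path d))ᗮ := fun y => by
    change accL (b.constr ℝ (fun i => m (b i)) y) ∈ _
    rw [Module.Basis.constr_apply_fintype, map_sum]
    exact Submodule.sum_mem _ fun i _ => by
      rw [map_smul]; exact Submodule.smul_mem _ _ (hmo _)
  refine ⟨Φ, fun y i => congrFun (hΦ y) i, fun w => ?_⟩
  -- The difference vanishes at the times `t i`, so Pythagoras applies.
  have hN : accL (w - Φ (evalAllL t w)) ∈ (vanishingAcc t : Submodule ℝ (L2Path d)) :=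
    ⟨_, by change evalAllL t _ = 0; rw [evalAllL_sub, hΦ, sub_self], rfl⟩
  have horth := (Submodule.mem_orthogonal' _ _).1 (hΦo (evalAllL t w)) _ hN
  have hpy := norm_add_sq_eq_norm_sq_add_norm_sq_of_inner_eq_zero _ _ horth
  rw [accL_sub, add_sub_cancel] at hpy
  nlinarith [norm_nonneg (accL w), norm_nonneg (accL (Φ (evalAllL t w))),
    mul_self_nonneg ‖accL w - accL (Φ (evalAllL t w))‖]

/-! ### Optimal couplings -/

/-- The couplings of a finite family of measures. -/
structure IsCoupling {n : ℕ} (ρ : Fin n → Measure (Rd d)) (γ : Measure (Fin n → Rd d)) : Prop where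
  isProbabilityMeasure : IsProbabilityMeasure γ
  marginal : ∀ i, γ.map (fun y => y i) = ρ i

/-- With compact supports, one compact set carries all couplings: it yields both tightness and a
bound on the cost. -/
theorem IsCoupling.ae_mem_support {n : ℕ} {ρ : Fin n → Measure (Rd d)}
    {γ : Measure (Fin n → Rd d)} (h : IsCoupling ρ γ) :
    ∀ᵐ y ∂γ, y ∈ Set.pi univ fun i => (ρ i).support := by
  have : ∀ᵐ y ∂γ, ∀ i, y i ∈ (ρ i).support := ae_all_iff.2 fun i => by
    have h1 : ∀ᵐ z ∂(γ.map fun y => y i), z ∈ (ρ i).support := by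
      rw [h.marginal i]; exact Measure.support_mem_ae
    exact ae_of_ae_map (measurable_pi_apply i).aemeasurable h1
  filter_upwards [this] with y hy i _ using hy i

/-- The set of couplings of compactly supported probability measures is compact. -/
theorem isCompact_setOf_isCoupling {n : ℕ} (ρ : Fin n → Measure (Rd d))
    [hρ : ∀ i, IsProbabilityMeasure (ρ i)] (hc : ∀ i, IsCompact (ρ i).support) :
    IsCompact {γ : ProbabilityMeasure (Fin n → Rd d) | IsCoupling ρ γ} := by
  have hclosed : IsClosed {γ : ProbabilityMeasure (Fin n → Rd d) | IsCoupling ρ γ} := by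
    have heq : {γ : ProbabilityMeasure (Fin n → Rd d) | IsCoupling ρ γ} =
        ⋂ i, {γ | γ.map (measurable_pi_apply i).aemeasurable = ⟨ρ i, hρ i⟩} := by
      ext γ
      simp only [mem_ofPred_eq, mem_iInter]
      exact ⟨fun h i => Subtype.ext (h.marginal i),
        fun h => ⟨inferInstance, fun i => congrArg Subtype.val (h i)⟩⟩
    rw [heq]
    exact isClosed_iInter fun i => isClosed_eq
      (ProbabilityMeasure.continuous_map (continuous_apply i)) continuous_const
  -- Prokhorov's theorem; the same compact set serves every `ε`.
  rw [← hclosed.closure_eq]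
  refine isCompact_closure_of_isTightMeasureSet ?_
  rw [isTightMeasureSet_iff_exists_isCompact_measure_compl_le]
  refine fun ε _ => ⟨_, isCompact_univ_pi hc, ?_⟩
  rintro _ ⟨γ, hγ, rfl⟩
  have h0 : (γ : Measure (Fin n → Rd d)) (Set.pi univ fun i => (ρ i).support)ᶜ = 0 :=
    IsCoupling.ae_mem_support hγ
  rw [h0]
  exact zero_le

/-- A continuous finite cost attains its minimum over the couplings of compactly supported
probability measures, and the minimum is finite. -/
theorem exists_optimal_coupling {n : ℕ} (ρ : Fin n → Measure (Rd d))
    [hρ : ∀ i, IsProbabilityMeasure (ρ i)] (hc : ∀ i, IsCompact (ρ i).support)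
    {c : (Fin n → Rd d) → NNReal} (hcont : Continuous c) :
    ∃ γ, IsCoupling ρ γ ∧ ∫⁻ y, c y ∂γ < ⊤ ∧
      ∀ γ', IsCoupling ρ γ' → ∫⁻ y, c y ∂γ ≤ ∫⁻ y, c y ∂γ' := by
  -- Weak convergence tests only bounded functions, so `c` is truncated at its bound `M` on the
  -- product of the supports; no coupling sees the change.
  obtain ⟨M, hM⟩ := (isCompact_univ_pi hc).bddAbove_image hcont.continuousOn
  let cM : BoundedContinuousFunction (Fin n → Rd d) NNReal :=
    BoundedContinuousFunction.mkOfBound ⟨fun y => min (c y) M, by fun_prop⟩ M fun x y => by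
      rw [NNReal.dist_eq]
      have hx : ((min (c x) M : NNReal) : ℝ) ≤ M := NNReal.coe_le_coe.2 (min_le_right _ _)
      have hy : ((min (c y) M : NNReal) : ℝ) ≤ M := NNReal.coe_le_coe.2 (min_le_right _ _)
      exact abs_sub_le_of_nonneg_of_le (NNReal.coe_nonneg _) hx (NNReal.coe_nonneg _) hy
  have hcM : ∀ γ, IsCoupling ρ γ → ∫⁻ y, c y ∂γ = ∫⁻ y, cM y ∂γ := fun γ hγ => by
    refine lintegral_congr_ae ?_
    filter_upwards [hγ.ae_mem_support] with y hy
    change (c y : ℝ≥0∞) = ((min (c y) M : NNReal) : ℝ≥0∞)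
    rw [min_eq_left (hM ⟨y, hy, rfl⟩)]
  have hcontI : Continuous fun γ : ProbabilityMeasure (Fin n → Rd d) => ∫⁻ y, cM y ∂γ :=
    continuous_iff_continuousAt.2 fun γ =>
      ProbabilityMeasure.tendsto_iff_forall_lintegral_tendsto.1 tendsto_id cM
  have hne : {γ : ProbabilityMeasure (Fin n → Rd d) | IsCoupling ρ γ}.Nonempty :=
    ⟨⟨Measure.pi ρ, inferInstance⟩, inferInstanceAs (IsProbabilityMeasure (Measure.pi ρ)),
      fun i => (measurePreserving_eval ρ i).map_eq⟩
  obtain ⟨γ, hγ, hmin⟩ := (isCompact_setOf_isCoupling ρ hc).exists_isMinOn hne hcontI.continuousOn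
  refine ⟨γ, hγ, ?_, fun γ' hγ' => ?_⟩
  · rw [hcM _ hγ]
    refine (lintegral_mono (g := fun _ => (M : ℝ≥0∞)) fun y =>
      ENNReal.coe_le_coe.2 (min_le_right (c y) M)).trans_lt ?_
    simp
  · rw [hcM _ hγ, hcM _ hγ']
    exact hmin (show IsCoupling ρ (⟨γ', hγ'.isProbabilityMeasure⟩ : ProbabilityMeasure _) from hγ')

/-! ### The Kantorovich problem -/

/-- The Kantorovich problem has a solution of finite cost. -/
theorem exists_optimal_kantorovich {n : ℕ} {t : Fin n → I} (ht : Function.Injective t)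
    (ρ : Fin n → Measure (Rd d)) [hρ : ∀ i, IsProbabilityMeasure (ρ i)]
    (hc : ∀ i, IsCompact (ρ i).support) :
    ∃ μ : Measure (H2Path d), KantorovichAdmissible t ρ μ ∧ kantorovichCost μ < ⊤ ∧
      kantorovichCost μ = kantorovichInf t ρ := by
  obtain ⟨Φ, hΦ, hmin⟩ := exists_minimal_interpolation (d := d) ht
  have henergy : ∀ w : sobolev d, energy (toPath w) = ((‖accL w‖₊ ^ 2 : NNReal) : ℝ≥0∞) :=
    fun w => energy_eq_coe _
  have hcont : Continuous fun y => ‖accL (Φ y)‖₊ ^ 2 := by fun_prop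
  obtain ⟨γ, hγ, hfin, hopt⟩ := exists_optimal_coupling ρ hc hcont
  have hm : Measurable fun y => toPath (Φ y) := (continuous_toPath.comp Φ.continuous).measurable
  have hcost : kantorovichCost (γ.map fun y => toPath (Φ y))
      = ∫⁻ y, ((‖accL (Φ y)‖₊ ^ 2 : NNReal) : ℝ≥0∞) ∂γ := by
    rw [kantorovichCost, lintegral_map continuous_energy.measurable hm]
    simp_rw [henergy]
  have := hγ.isProbabilityMeasure
  have hadm : KantorovichAdmissible t ρ (γ.map fun y => toPath (Φ y)) := by
    refine ⟨Measure.isProbabilityMeasure_map hm.aemeasurable, fun i => ?_⟩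
    rw [Measure.map_map (continuous_eval _).measurable hm, ← hγ.marginal i]
    congr 1
    funext y
    exact hΦ y i
  refine ⟨_, hadm, hcost ▸ hfin, le_antisymm ?_ (iInf₂_le _ hadm)⟩
  -- The values of a plan at the times `t i` form a coupling, and each path has at least the energy
  -- of the minimal interpolant of its values.
  refine le_iInf₂ fun μ hμ => ?_
  have := hμ.isProbabilityMeasure
  have hev : Measurable fun (x : H2Path d) i => eval (t i) x :=
    (continuous_pi fun i => continuous_eval _).measurable
  have hcoup : IsCoupling ρ (μ.map fun x i => eval (t i) x) :=
    ⟨Measure.isProbabilityMeasure_map hev.aemeasurable, fun i => by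
      rw [Measure.map_map (measurable_pi_apply i) hev]; exact hμ.marginal i⟩
  rw [hcost]
  refine (hopt _ hcoup).trans ?_
  rw [lintegral_map (f := fun y => ((‖accL (Φ y)‖₊ ^ 2 : NNReal) : ℝ≥0∞))
    (ENNReal.continuous_coe.comp hcont).measurable hev]
  refine lintegral_mono fun x => ?_
  have h1 := henergy (ofPath x)
  rw [toPath_ofPath] at h1
  change ((‖accL (Φ (evalAllL t (ofPath x)))‖₊ ^ 2 : NNReal) : ℝ≥0∞) ≤ energy x
  rw [h1, ENNReal.coe_le_coe]
  exact pow_le_pow_left' (NNReal.coe_le_coe.1 (hmin (ofPath x))) 2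

/-! ### The Monge problems -/

/-- Monge maps induce Kantorovich measures of the same cost. -/
theorem kantorovichInf_le_mongeCost {n : ℕ} {t : Fin n → I} {ρ : Fin n → Measure (Rd d)}
    {μ₀ : Measure (Rd d)} [IsProbabilityMeasure μ₀] {φ : Rd d → H2Path d}
    (hφ : MongeAdmissible μ₀ t ρ φ) : kantorovichInf t ρ ≤ mongeCost μ₀ φ := by
  have hm : Measurable φ := measurable_of_forall_measurable_eval hφ.measurable
  have hadm : KantorovichAdmissible t ρ (μ₀.map φ) :=
    ⟨Measure.isProbabilityMeasure_map hm.aemeasurable, fun i => by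
      rw [Measure.map_map (continuous_eval _).measurable hm]; exact hφ.marginal i⟩
  refine (iInf₂_le _ hadm).trans_eq ?_
  rw [kantorovichCost, lintegral_map continuous_energy.measurable hm, mongeCost]

theorem kantorovichInf_le_mongeInf {n : ℕ} (t : Fin n → I) (ρ : Fin n → Measure (Rd d))
    (μ₀ : Measure (Rd d)) [IsProbabilityMeasure μ₀] : kantorovichInf t ρ ≤ mongeInf μ₀ t ρ :=
  le_iInf₂ fun _ hφ => kantorovichInf_le_mongeCost hφ

/-- With an atomless reference measure, every Kantorovich measure is induced by a Monge map. -/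
theorem mongeInf_le_kantorovichInf {n : ℕ} (t : Fin n → I) (ρ : Fin n → Measure (Rd d))
    (μ₀ : Measure (Rd d)) [IsProbabilityMeasure μ₀] (hμ₀ : ∀ x, μ₀ {x} = 0) :
    mongeInf μ₀ t ρ ≤ kantorovichInf t ρ := by
  refine le_iInf₂ fun μ hμ => ?_
  have := hμ.isProbabilityMeasure
  obtain ⟨T, hT, hmap⟩ := exists_measurable_map_eq_of_atomless μ₀ hμ₀ μ (by simp)
  have hadm : MongeAdmissible μ₀ t ρ T := by
    refine ⟨fun s => (continuous_eval s).measurable.comp hT, fun i => ?_⟩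
    rw [← hμ.marginal i, ← hmap, Measure.map_map (continuous_eval _).measurable hT]
    rfl
  refine (iInf₂_le _ hadm).trans_eq ?_
  rw [kantorovichCost, ← hmap, lintegral_map continuous_energy.measurable hT, mongeCost]

/-- A separable metric space has countable measurable partitions into arbitrarily small cells. -/
theorem exists_measurable_small_fibers {X : Type*} [PseudoMetricSpace X]
    [TopologicalSpace.SeparableSpace X] [Nonempty X] [MeasurableSpace X] [OpensMeasurableSpace X]
    {δ : ℝ} (hδ : 0 < δ) : ∃ q : X → ℕ, Measurable q ∧ ∀ x y, q x = q y → dist x y ≤ δ := by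
  classical
  have hex : ∀ x : X, ∃ k, dist x (TopologicalSpace.denseSeq X k) < δ / 2 := fun x => by
    obtain ⟨k, hk⟩ := (TopologicalSpace.denseRange_denseSeq X).exists_dist_lt x (half_pos hδ)
    exact ⟨k, hk⟩
  refine ⟨fun x => Nat.find (hex x), measurable_find hex fun k => ?_, fun x y hxy => ?_⟩
  · exact measurableSet_ball
  · have hx := Nat.find_spec (hex x)
    have hy := Nat.find_spec (hex y)
    rw [← show Nat.find (hex x) = Nat.find (hex y) from hxy, dist_comm] at hy
    linarith [dist_triangle x (TopologicalSpace.denseSeq X (Nat.find (hex x))) y]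

/-- The cross term is absorbed by `2‖u‖ ≤ ‖u‖² + 1`, multiplied by `η`. The bound is affine in
`‖u‖²`, hence can be integrated. -/
theorem nnnorm_add_sq_le {E : Type*} [SeminormedAddCommGroup E] {u v : E} {η : NNReal}
    (hv : ‖v‖₊ ≤ η) : ‖u + v‖₊ ^ 2 ≤ (1 + η) * ‖u‖₊ ^ 2 + (η ^ 2 + η) := by
  have h1 : ‖u + v‖₊ ^ 2 ≤ (‖u‖₊ + η) ^ 2 :=
    pow_le_pow_left' ((nnnorm_add_le u v).trans (add_le_add le_rfl hv)) 2
  refine h1.trans (NNReal.coe_le_coe.1 ?_)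
  push_cast
  nlinarith [mul_nonneg η.coe_nonneg (sq_nonneg (‖u‖ - 1))]

/-- Correcting a transport compatible with a fine partition produces Monge maps starting at the
identity whose cost is close to a given Kantorovich cost. -/
theorem mongeInfId_le_of_pos {n : ℕ} {t : Fin n → I} (ht : Function.Injective t) {i₀ : Fin n}
    (hi₀ : t i₀ = 0) {ρ : Fin n → Measure (Rd d)} [IsProbabilityMeasure (ρ i₀)]
    (hatom : ∀ x, ρ i₀ {x} = 0) {μ : Measure (H2Path d)} (hμ : KantorovichAdmissible t ρ μ)
    {η : NNReal} (hη : 0 < η) :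
    mongeInfId (ρ i₀) t ρ
      ≤ ((1 + η : NNReal) : ℝ≥0∞) * kantorovichCost μ + ((η ^ 2 + η : NNReal) : ℝ≥0∞) := by
  have := hμ.isProbabilityMeasure
  obtain ⟨R, hR⟩ := exists_path_polynomial (d := d)
    (Lagrange.basis Finset.univ (fun i => (t i : ℝ)) i₀)
  have hinj : Set.InjOn (fun i => (t i : ℝ)) (Finset.univ : Finset (Fin n)) :=
    (Subtype.val_injective.comp ht).injOn
  have hR0 : ∀ v, evalL 0 (R v) = v := fun v => by
    rw [hR, ← hi₀, Lagrange.eval_basis_self hinj (Finset.mem_univ i₀), one_smul]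
  have hRi : ∀ i, i ≠ i₀ → ∀ v, evalL (t i) (R v) = 0 := fun i hi v => by
    rw [hR, Lagrange.eval_basis_of_ne (v := fun i => (t i : ℝ)) hi.symm (Finset.mem_univ i),
      zero_smul]
  set C : ℝ := ‖accL ∘L R‖
  have hC0 : 0 ≤ C := norm_nonneg _
  -- A cell of this diameter keeps the acceleration of the correction below `η`; the `+ 1` covers `C
  -- = 0`.
  have hδ : 0 < (η : ℝ) / (C + 1) := by positivity
  obtain ⟨q, hq, hqdist⟩ := exists_measurable_small_fibers (X := Rd d) hδ
  have he0 : Measurable (eval 0 : H2Path d → Rd d) := (continuous_eval 0).measurable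
  -- The cell masses match because the starting points of `μ` have law `ρ i₀`.
  obtain ⟨T, hT, hmap, hTq⟩ := exists_measurable_map_eq_of_atomless_of_partition (ρ i₀) hatom μ
    (p := q) (q := fun x => q (eval 0 x)) hq (hq.comp he0)
    (by rw [← hμ.marginal i₀, Measure.map_map hq (continuous_eval _).measurable, hi₀]; rfl)
  -- The correction moves the start to `x` and leaves the values at the other `t i` unchanged.
  let φ : Rd d → H2Path d := fun x => toPath (ofPath (T x) + R (x - eval 0 (T x)))
  have heval : ∀ s x, eval s (φ x) = eval s (T x) + evalL s (R (x - eval 0 (T x))) :=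
    fun s x => rfl
  have hφ0 : ∀ x, eval 0 (φ x) = x := fun x => by
    rw [heval, hR0, add_sub_cancel]
  have hφ : MongeAdmissible (ρ i₀) t ρ φ := by
    refine ⟨fun s => ?_, fun i => ?_⟩
    · simp_rw [heval]
      have h1 : Measurable fun x => eval s (T x) := (continuous_eval s).measurable.comp hT
      have h2 : Measurable fun x => x - eval 0 (T x) := measurable_id.sub (he0.comp hT)
      have h3 : Continuous fun v => evalL s (R v) := (evalL s).continuous.comp R.continuous
      exact h1.add (h3.measurable.comp h2)
    · by_cases hi : i = i₀
      · subst hi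
        rw [hi₀]
        simp_rw [hφ0]
        exact Measure.map_id
      · have : (fun x => eval (t i) (φ x)) = eval (t i) ∘ T := funext fun x => by
          rw [heval, hRi i hi, add_zero, Function.comp_apply]
        rw [this, ← Measure.map_map (continuous_eval _).measurable hT, hmap, hμ.marginal i]
  refine (iInf₂_le_of_le φ hφ (iInf_le _ hφ0)).trans ?_
  have hbound : ∀ᵐ x ∂(ρ i₀), energy (φ x)
      ≤ ((1 + η : NNReal) : ℝ≥0∞) * energy (T x) + ((η ^ 2 + η : NNReal) : ℝ≥0∞) := by
    filter_upwards [hTq] with x hx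
    have hv : ‖accL (R (x - eval 0 (T x)))‖₊ ≤ η := by
      have h1 : ‖x - eval 0 (T x)‖ ≤ η / (C + 1) := by
        rw [← dist_eq_norm]; exact hqdist _ _ hx.symm
      refine NNReal.coe_le_coe.1 ?_
      calc ‖(accL ∘L R) (x - eval 0 (T x))‖ ≤ C * ‖x - eval 0 (T x)‖ :=
            ContinuousLinearMap.le_opNorm _ _
        _ ≤ C * (η / (C + 1)) := mul_le_mul_of_nonneg_left h1 hC0
        _ ≤ (C + 1) * (η / (C + 1)) := by gcongr; linarith
        _ = η := by field_simp
    have key := nnnorm_add_sq_le (u := acc (T x)) hv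
    rw [energy_eq_coe, energy_eq_coe, ← ENNReal.coe_mul, ← ENNReal.coe_add]
    exact ENNReal.coe_le_coe.2 key
  calc mongeCost (ρ i₀) φ
      ≤ ∫⁻ x, (((1 + η : NNReal) : ℝ≥0∞) * energy (T x) + ((η ^ 2 + η : NNReal) : ℝ≥0∞)) ∂(ρ i₀) :=
        lintegral_mono_ae hbound
    _ = _ := by
        rw [lintegral_add_right _ measurable_const,
          lintegral_const_mul (f := fun x => energy (T x)) _
            (continuous_energy.measurable.comp hT), lintegral_const,
          measure_univ, mul_one, kantorovichCost, ← hmap,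
          lintegral_map continuous_energy.measurable hT]

/-- Obtained from `mongeInfId_le_of_pos` as `η` tends to 0, the case of infinite cost being trivial.
-/
theorem mongeInfId_le_kantorovichCost {n : ℕ} {t : Fin n → I} (ht : Function.Injective t)
    {i₀ : Fin n} (hi₀ : t i₀ = 0) {ρ : Fin n → Measure (Rd d)} [IsProbabilityMeasure (ρ i₀)]
    (hatom : ∀ x, ρ i₀ {x} = 0) {μ : Measure (H2Path d)} (hμ : KantorovichAdmissible t ρ μ) :
    mongeInfId (ρ i₀) t ρ ≤ kantorovichCost μ := by
  by_cases htop : kantorovichCost μ = ⊤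
  · rw [htop]; exact le_top
  lift kantorovichCost μ to NNReal using htop with K hK
  have hcont : Continuous fun η : NNReal => ((1 + η) * K + (η ^ 2 + η) : NNReal) := by fun_prop
  have hlim : Tendsto (fun η : NNReal => (((1 + η) * K + (η ^ 2 + η) : NNReal) : ℝ≥0∞))
      (𝓝[>] 0) (𝓝 (K : ℝ≥0∞)) := by
    have := ((ENNReal.continuous_coe.comp hcont).tendsto 0).mono_left
      (nhdsWithin_le_nhds (s := Ioi 0))
    simpa [Function.comp_def] using this
  refine ge_of_tendsto hlim (eventually_nhdsWithin_of_forall fun η hη => ?_)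
  have := mongeInfId_le_of_pos ht hi₀ hatom hμ hη
  rw [← hK] at this
  exact_mod_cast this

end WassersteinSpline

end

open WassersteinSpline in
theorem mainTheorem1 (d n : ℕ) (hn : 3 ≤ n) (t : Fin n → unitInterval) (ht : StrictMono t)
    (ht_first : t ⟨0, by omega⟩ = 0) (ht_last : t ⟨n - 1, by omega⟩ = 1)
    (ρ : Fin n → MeasureTheory.Measure (Rd d))
    (hρ_prob : ∀ i, MeasureTheory.IsProbabilityMeasure (ρ i))
    (hρ_compact : ∀ i, IsCompact (ρ i).support)
    (hρ_atomless : ∀ x, ρ ⟨0, by omega⟩ {x} = 0) :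
    -- (MS) for every atomless reference probability measure, in particular for the first marginal
    (∀ μ₀ : MeasureTheory.Measure (Rd d), MeasureTheory.IsProbabilityMeasure μ₀ →
      (∀ x, μ₀ {x} = 0) → mongeInf μ₀ t ρ = kantorovichInf t ρ) ∧
    -- (MS) with the first marginal as reference measure and maps starting at the identity
    mongeInfId (ρ ⟨0, by omega⟩) t ρ = kantorovichInf t ρ ∧
    -- the Kantorovich infimum is finite and attained
    kantorovichInf t ρ < ⊤ ∧
    ∃ μ : MeasureTheory.Measure (H2Path d),
      KantorovichAdmissible t ρ μ ∧ kantorovichCost μ = kantorovichInf t ρ := by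
  obtain ⟨μ, hμ, hfin, hopt⟩ := exists_optimal_kantorovich ht.injective ρ hρ_compact
  refine ⟨fun μ₀ hμ₀ hatom => ?_, ?_, hopt ▸ hfin, μ, hμ, hopt⟩
  · exact le_antisymm (mongeInf_le_kantorovichInf t ρ μ₀ hatom) (kantorovichInf_le_mongeInf t ρ μ₀)
  · refine le_antisymm ?_ ?_
    · exact le_iInf₂ fun ν hν =>
        mongeInfId_le_kantorovichCost ht.injective ht_first hρ_atomless hν
    · exact le_iInf₂ fun φ hφ => le_iInf fun _ => kantorovichInf_le_mongeCost hφ
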